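/- **Language.** Fix a set of individual constants, a set of predicate symbols with arities, and for each $n\ge 1$ a set of $n$-ary relational constants (any of these may be empty). There are countably infinitely many individual variables $x,y,\dots$ and, disjoint from them, countably infinitely many individual parameters $a,b,c,\dots$; likewise, for each $n\ge1$, countably infinitely many $n$-ary relational variables $X,Y,\dots$ and $n$-ary relational parameters $A,B,C,\dots$. Terms are individual variables, parameters and constants. Atomic formulas are $t_1=t_2$, $P(t_1,\dots,t_n)$, $X=Y$ and $X(t_1,\dots,t_n)$, where the $t_i$ are terms, $P$ is an $n$-ary predicate symbol, and $X,Y$ are $n$-ary relational variables, parameters or constants. Formulas are built from these with $\neg,\wedge,\vee,\to,\leftrightarrow$, the quantifiers $\forall x,\exists x,\forall X,\exists X$, and the formation of $(\lambda x\,\psi)t$ ($t$ a term), $(\lambda x\,\psi)\iota y\,\varphi$, and $(\lambda X\,\psi)\iota Y\,\varphi$ ($X,Y$ of the same arity); $\lambda x,\lambda X$ bind in $\psi$, $\iota y,\iota Y$ bind in $\varphi$. $\varphi^x_b$ (resp. $\varphi^X_B$) is the result of replacing the free occurrences of $x$ (resp. $X$) in $\varphi$ by the parameter $b$ (resp. $B$,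 of the same arity). A sequent $\Gamma\Rightarrow\Delta$ is a pair of finite multisets of formulas. **The calculus $\mathbf{RLL}$.** Below, $b,c,b_1,\dots$ are arbitrary individual parameters and $B,C$ arbitrary relational parameters; $a$ (resp. $A$) is an eigenvariable: it does not occur in $\Gamma,\Delta,\varphi$, nor in $\psi$ in the rules $(\iota_1\Rightarrow)$, $(\iota_1^2\Rightarrow)$, and it is different from $b$ (resp. $B$) in $(\Rightarrow\iota)$, $(\Rightarrow\iota^2)$; $a_1,\dots,a_n$ are pairwise distinct and do not occur in $\Gamma,\Delta$. "Premises / conclusion": - (AX) $\varphi\Rightarrow\varphi$; weakening and contraction on both sides; (Cut) $\Gamma\Rightarrow\Delta,\varphi$ and $\varphi,\Pi\Rightarrow\Sigma$ / $\Gamma,\Pi\Rightarrow\Delta,\Sigma$. - $(\wedge\Rightarrow)$ $\varphi,\psi,\Gamma\Rightarrow\Delta$ / $\varphi\wedge\psi,\Gamma\Rightarrow\Delta$; $(\Rightarrow\wedge)$ $\Gamma\Rightarrow\Delta,\varphi$ and $\Gamma\Rightarrow\Delta,\psi$ / $\Gamma\Rightarrow\Delta,\varphi\wedge\psi$. - $(\vee\Rightarrow)$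 $\varphi,\Gamma\Rightarrow\Delta$ and $\psi,\Gamma\Rightarrow\Delta$ / $\varphi\vee\psi,\Gamma\Rightarrow\Delta$; $(\Rightarrow\vee)$ $\Gamma\Rightarrow\Delta,\varphi,\psi$ / $\Gamma\Rightarrow\Delta,\varphi\vee\psi$. - $(\neg\Rightarrow)$ $\Gamma\Rightarrow\Delta,\varphi$ / $\neg\varphi,\Gamma\Rightarrow\Delta$; $(\Rightarrow\neg)$ $\varphi,\Gamma\Rightarrow\Delta$ / $\Gamma\Rightarrow\Delta,\neg\varphi$. - $(\to\Rightarrow)$ $\Gamma\Rightarrow\Delta,\varphi$ and $\psi,\Gamma\Rightarrow\Delta$ / $\varphi\to\psi,\Gamma\Rightarrow\Delta$; $(\Rightarrow\to)$ $\varphi,\Gamma\Rightarrow\Delta,\psi$ / $\Gamma\Rightarrow\Delta,\varphi\to\psi$. - $(\leftrightarrow\Rightarrow)$ $\Gamma\Rightarrow\Delta,\varphi,\psi$ and $\varphi,\psi,\Gamma\Rightarrow\Delta$ / $\varphi\leftrightarrow\psi,\Gamma\Rightarrow\Delta$; $(\Rightarrow\leftrightarrow)$ $\varphi,\Gamma\Rightarrow\Delta,\psi$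 and $\psi,\Gamma\Rightarrow\Delta,\varphi$ / $\Gamma\Rightarrow\Delta,\varphi\leftrightarrow\psi$. - $(\forall\Rightarrow)$ $\varphi^x_b,\Gamma\Rightarrow\Delta$ / $\forall x\varphi,\Gamma\Rightarrow\Delta$; $(\Rightarrow\forall)$ $\Gamma\Rightarrow\Delta,\varphi^x_a$ / $\Gamma\Rightarrow\Delta,\forall x\varphi$; $(\exists\Rightarrow)$ $\varphi^x_a,\Gamma\Rightarrow\Delta$ / $\exists x\varphi,\Gamma\Rightarrow\Delta$; $(\Rightarrow\exists)$ $\Gamma\Rightarrow\Delta,\varphi^x_b$ / $\Gamma\Rightarrow\Delta,\exists x\varphi$. - $(=+)$ $b=b,\Gamma\Rightarrow\Delta$ / $\Gamma\Rightarrow\Delta$; $(=-)$ $\mathscr A^x_c,\Gamma\Rightarrow\Delta$ / $b=c,\mathscr A^x_b,\Gamma\Rightarrow\Delta$ for atomic $\mathscr A$. - $(\lambda\Rightarrow)$ $\psi^x_b,\Gamma\Rightarrow\Delta$ / $(\lambda x\psi)b,\Gamma\Rightarrow\Delta$; $(\Rightarrow\lambda)$ $\Gamma\Rightarrow\Delta,\psi^x_b$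 / $\Gamma\Rightarrow\Delta,(\lambda x\psi)b$. - $(\iota_1\Rightarrow)$ $\varphi^y_a,\psi^x_a,\Gamma\Rightarrow\Delta$ / $(\lambda x\psi)\iota y\varphi,\Gamma\Rightarrow\Delta$; $(\iota_2\Rightarrow)$ $\Gamma\Rightarrow\Delta,\varphi^y_b$ and $\Gamma\Rightarrow\Delta,\varphi^y_c$ and $b=c,\Gamma\Rightarrow\Delta$ / $(\lambda x\psi)\iota y\varphi,\Gamma\Rightarrow\Delta$; $(\Rightarrow\iota)$ $\Gamma\Rightarrow\Delta,\varphi^y_b$ and $\Gamma\Rightarrow\Delta,\psi^x_b$ and $\varphi^y_a,\Gamma\Rightarrow\Delta,a=b$ / $\Gamma\Rightarrow\Delta,(\lambda x\psi)\iota y\varphi$. - $(=^2\Rightarrow)$ $\Gamma\Rightarrow\Delta,X(b_1,\dots,b_n),Y(b_1,\dots,b_n)$ and $X(b_1,\dots,b_n),Y(b_1,\dots,b_n),\Gamma\Rightarrow\Delta$ / $X=Y,\Gamma\Rightarrow\Delta$; $(\Rightarrow=^2)$ $X(a_1,\dots,a_n),\Gamma\Rightarrow\Delta,Y(a_1,\dots,a_n)$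 and $Y(a_1,\dots,a_n),\Gamma\Rightarrow\Delta,X(a_1,\dots,a_n)$ / $\Gamma\Rightarrow\Delta,X=Y$. - The rules $(\forall^2\Rightarrow),(\Rightarrow\forall^2),(\exists^2\Rightarrow),(\Rightarrow\exists^2),(\iota^2_1\Rightarrow),(\iota^2_2\Rightarrow),(\Rightarrow\iota^2)$, obtained from the corresponding first-order rules by replacing $x,y,a,b,c$ with $X,Y,A,B,C$ (all of the same arity). A derivation of a sequent is a finite tree of sequents with that sequent at the root in which every node follows from its immediate predecessors by a rule (leaves being axioms); it is cut-free if (Cut) is not used. **Theorem (cut admissibility).** For every sequent $\Gamma\Rightarrow\Delta$: if $\Gamma\Rightarrow\Delta$ has a derivation in $\mathbf{RLL}$, then it has a cut-free derivation in $\mathbf{RLL}$. The same holds when only formulas in which no (individual or relational) variable occurs free are allowed in sequents and derivations. -/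

import Mathlib

namespace RLL

universe u

/-- The non-logical symbols: individual constants, predicate symbols with their arities, and
relational constants with their (positive) arities. Each of the types may be empty. -/
structure Signature where
  Con : Type u
  Pred : ℕ → Type u
  RCon : ℕ+ → Type u

/-- Terms: individual variables, individual parameters and individual constants. Variables and
parameters form two disjoint countably infinite supplies of symbols. -/
inductive Term (L : Signature.{u}) : Type u
  | var (x : ℕ) : Term L
  | par (a : ℕ) : Term L
  | con (k : L.Con) : Term L

/-- Relational variables, parameters and constants of arity `n`; there are countably many
variables and countably many parameters of each arity `n ≥ 1`. These are not terms. -/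
inductive RTerm (L : Signature.{u}) (n : ℕ+) : Type u
  | var (X : ℕ) : RTerm L n
  | par (A : ℕ) : RTerm L n
  | con (K : L.RCon n) : RTerm L n

/-- Formulas of the second-order language.
* `lam x ψ t` is the lambda atom `(λx ψ) t` for a term `t`;
* `lamIota x ψ y φ` is the lambda atom `(λx ψ) ιy φ` (`x` is bound in `ψ` only, `y` in `φ` only);
* `lamIota₂ n X ψ Y φ` is `(λX ψ) ιY φ` for `n`-ary relational variables `X`, `Y`. -/
inductive Formula (L : Signature.{u}) : Type u
  | eq (s t : Term L) : Formula L
  | pred {n : ℕ} (P : L.Pred n) (ts : Fin n → Term L) : Formula L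
  | relEq {n : ℕ+} (X Y : RTerm L n) : Formula L
  | rel {n : ℕ+} (X : RTerm L n) (ts : Fin n → Term L) : Formula L
  | neg (φ : Formula L) : Formula L
  | and (φ ψ : Formula L) : Formula L
  | or (φ ψ : Formula L) : Formula L
  | imp (φ ψ : Formula L) : Formula L
  | iff (φ ψ : Formula L) : Formula L
  | all (x : ℕ) (φ : Formula L) : Formula L
  | ex (x : ℕ) (φ : Formula L) : Formula L
  | all₂ (n : ℕ+) (X : ℕ) (φ : Formula L) : Formula L
  | ex₂ (n : ℕ+) (X : ℕ) (φ : Formula L) : Formula L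
  | lam (x : ℕ) (ψ : Formula L) (t : Term L) : Formula L
  | lamIota (x : ℕ) (ψ : Formula L) (y : ℕ) (φ : Formula L) : Formula L
  | lamIota₂ (n : ℕ+) (X : ℕ) (ψ : Formula L) (Y : ℕ) (φ : Formula L) : Formula L

variable {L : Signature.{u}}

/-- Replace the variable `x` by the parameter `b`. -/
def Term.subst (x b : ℕ) : Term L → Term L
  | .var y => if y = x then .par b else .var y
  | .par a => .par a
  | .con k => .con k

/-- Replace the `n`-ary relational variable `X` by the `n`-ary relational parameter `B`. -/
def RTerm.subst (n : ℕ+) (X B : ℕ) {m : ℕ+} : RTerm L m → RTerm L m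
  | .var Y => if m = n ∧ Y = X then .par B else .var Y
  | .par A => .par A
  | .con K => .con K

namespace Formula

/-- `φ.subst x b` replaces the free occurrences of the individual variable `x` in `φ` by the
individual parameter `b`. Parameters are never bound, so nothing can be captured. -/
def subst (x b : ℕ) : Formula L → Formula L
  | eq s t => eq (s.subst x b) (t.subst x b)
  | pred P ts => pred P (fun i => (ts i).subst x b)
  | relEq X Y => relEq X Y
  | rel X ts => rel X (fun i => (ts i).subst x b)
  | neg φ => neg (φ.subst x b)
  | and φ ψ => and (φ.subst x b) (ψ.subst x b)
  | or φ ψ => or (φ.subst x b) (ψ.subst x b)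
  | imp φ ψ => imp (φ.subst x b) (ψ.subst x b)
  | iff φ ψ => iff (φ.subst x b) (ψ.subst x b)
  | all y φ => all y (if y = x then φ else φ.subst x b)
  | ex y φ => ex y (if y = x then φ else φ.subst x b)
  | all₂ n X φ => all₂ n X (φ.subst x b)
  | ex₂ n X φ => ex₂ n X (φ.subst x b)
  | lam y ψ t => lam y (if y = x then ψ else ψ.subst x b) (t.subst x b)
  | lamIota y ψ z φ =>
      lamIota y (if y = x then ψ else ψ.subst x b) z (if z = x then φ else φ.subst x b)
  | lamIota₂ n X ψ Y φ => lamIota₂ n X (ψ.subst x b) Y (φ.subst x b)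

/-- `φ.subst₂ n X B` replaces the free occurrences of the `n`-ary relational variable `X` in `φ`
by the `n`-ary relational parameter `B`. -/
def subst₂ (n : ℕ+) (X B : ℕ) : Formula L → Formula L
  | eq s t => eq s t
  | pred P ts => pred P ts
  | relEq Y Z => relEq (Y.subst n X B) (Z.subst n X B)
  | rel Y ts => rel (Y.subst n X B) ts
  | neg φ => neg (φ.subst₂ n X B)
  | and φ ψ => and (φ.subst₂ n X B) (ψ.subst₂ n X B)
  | or φ ψ => or (φ.subst₂ n X B) (ψ.subst₂ n X B)
  | imp φ ψ => imp (φ.subst₂ n X B) (ψ.subst₂ n X B)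
  | iff φ ψ => iff (φ.subst₂ n X B) (ψ.subst₂ n X B)
  | all y φ => all y (φ.subst₂ n X B)
  | ex y φ => ex y (φ.subst₂ n X B)
  | all₂ m Y φ => all₂ m Y (if m = n ∧ Y = X then φ else φ.subst₂ n X B)
  | ex₂ m Y φ => ex₂ m Y (if m = n ∧ Y = X then φ else φ.subst₂ n X B)
  | lam y ψ t => lam y (ψ.subst₂ n X B) t
  | lamIota y ψ z φ => lamIota y (ψ.subst₂ n X B) z (φ.subst₂ n X B)
  | lamIota₂ m Y ψ Z φ =>
      lamIota₂ m Y (if m = n ∧ Y = X then ψ else ψ.subst₂ n X B)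
        Z (if m = n ∧ Z = X then φ else φ.subst₂ n X B)

/-- The individual parameter `a` occurs in the formula. -/
def HasPar (a : ℕ) : Formula L → Prop
  | eq s t => s = .par a ∨ t = .par a
  | pred _ ts => ∃ i, ts i = .par a
  | relEq _ _ => False
  | rel _ ts => ∃ i, ts i = .par a
  | neg φ => φ.HasPar a
  | and φ ψ => φ.HasPar a ∨ ψ.HasPar a
  | or φ ψ => φ.HasPar a ∨ ψ.HasPar a
  | imp φ ψ => φ.HasPar a ∨ ψ.HasPar a
  | iff φ ψ => φ.HasPar a ∨ ψ.HasPar a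
  | all _ φ => φ.HasPar a
  | ex _ φ => φ.HasPar a
  | all₂ _ _ φ => φ.HasPar a
  | ex₂ _ _ φ => φ.HasPar a
  | lam _ ψ t => ψ.HasPar a ∨ t = .par a
  | lamIota _ ψ _ φ => ψ.HasPar a ∨ φ.HasPar a
  | lamIota₂ _ _ ψ _ φ => ψ.HasPar a ∨ φ.HasPar a

/-- The `n`-ary relational parameter `A` occurs in the formula. -/
def HasRPar (n : ℕ+) (A : ℕ) : Formula L → Prop
  | eq _ _ => False
  | pred _ _ => False
  | @relEq _ m X Y => m = n ∧ (X = .par A ∨ Y = .par A)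
  | @rel _ m X _ => m = n ∧ X = .par A
  | neg φ => φ.HasRPar n A
  | and φ ψ => φ.HasRPar n A ∨ ψ.HasRPar n A
  | or φ ψ => φ.HasRPar n A ∨ ψ.HasRPar n A
  | imp φ ψ => φ.HasRPar n A ∨ ψ.HasRPar n A
  | iff φ ψ => φ.HasRPar n A ∨ ψ.HasRPar n A
  | all _ φ => φ.HasRPar n A
  | ex _ φ => φ.HasRPar n A
  | all₂ _ _ φ => φ.HasRPar n A
  | ex₂ _ _ φ => φ.HasRPar n A
  | lam _ ψ _ => ψ.HasRPar n A
  | lamIota _ ψ _ φ => ψ.HasRPar n A ∨ φ.HasRPar n A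
  | lamIota₂ _ _ ψ _ φ => ψ.HasRPar n A ∨ φ.HasRPar n A

/-- The individual variable `x` occurs free in the formula. -/
def FreeVar (x : ℕ) : Formula L → Prop
  | eq s t => s = .var x ∨ t = .var x
  | pred _ ts => ∃ i, ts i = .var x
  | relEq _ _ => False
  | rel _ ts => ∃ i, ts i = .var x
  | neg φ => φ.FreeVar x
  | and φ ψ => φ.FreeVar x ∨ ψ.FreeVar x
  | or φ ψ => φ.FreeVar x ∨ ψ.FreeVar x
  | imp φ ψ => φ.FreeVar x ∨ ψ.FreeVar x
  | iff φ ψ => φ.FreeVar x ∨ ψ.FreeVar x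
  | all y φ => y ≠ x ∧ φ.FreeVar x
  | ex y φ => y ≠ x ∧ φ.FreeVar x
  | all₂ _ _ φ => φ.FreeVar x
  | ex₂ _ _ φ => φ.FreeVar x
  | lam y ψ t => (y ≠ x ∧ ψ.FreeVar x) ∨ t = .var x
  | lamIota y ψ z φ => (y ≠ x ∧ ψ.FreeVar x) ∨ (z ≠ x ∧ φ.FreeVar x)
  | lamIota₂ _ _ ψ _ φ => ψ.FreeVar x ∨ φ.FreeVar x

/-- The `n`-ary relational variable `X` occurs free in the formula. -/
def FreeRVar (n : ℕ+) (X : ℕ) : Formula L → Prop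
  | eq _ _ => False
  | pred _ _ => False
  | @relEq _ m Y Z => m = n ∧ (Y = .var X ∨ Z = .var X)
  | @rel _ m Y _ => m = n ∧ Y = .var X
  | neg φ => φ.FreeRVar n X
  | and φ ψ => φ.FreeRVar n X ∨ ψ.FreeRVar n X
  | or φ ψ => φ.FreeRVar n X ∨ ψ.FreeRVar n X
  | imp φ ψ => φ.FreeRVar n X ∨ ψ.FreeRVar n X
  | iff φ ψ => φ.FreeRVar n X ∨ ψ.FreeRVar n X
  | all _ φ => φ.FreeRVar n X
  | ex _ φ => φ.FreeRVar n X
  | all₂ m Y φ => ¬(m = n ∧ Y = X) ∧ φ.FreeRVar n X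
  | ex₂ m Y φ => ¬(m = n ∧ Y = X) ∧ φ.FreeRVar n X
  | lam _ ψ _ => ψ.FreeRVar n X
  | lamIota _ ψ _ φ => ψ.FreeRVar n X ∨ φ.FreeRVar n X
  | lamIota₂ m Y ψ Z φ =>
      (¬(m = n ∧ Y = X) ∧ ψ.FreeRVar n X) ∨ (¬(m = n ∧ Z = X) ∧ φ.FreeRVar n X)

/-- All variables of the formula, individual and relational, are bound (free places are taken by
parameters and constants only). -/
def VarsBound (φ : Formula L) : Prop :=
  (∀ x, ¬ φ.FreeVar x) ∧ ∀ n X, ¬ φ.FreeRVar n X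

/-- Atomic formulas: `s = t`, `P(t₁,…,tₙ)`, `X = Y`, `X(t₁,…,tₙ)`. -/
def IsAtomic : Formula L → Prop
  | eq _ _ => True
  | pred _ _ => True
  | relEq _ _ => True
  | rel _ _ => True
  | _ => False

end Formula

/-- A sequent `Γ ⟹ Δ`: a pair of finite multisets of formulas. -/
structure Sequent (L : Signature.{u}) where
  ante : Multiset (Formula L)
  succ : Multiset (Formula L)

infix:45 "⟹" => Sequent.mk

/-- No variable occurs free in the sequent. -/
def Sequent.VarsBound (S : Sequent L) : Prop :=
  (∀ φ ∈ S.ante, φ.VarsBound) ∧ ∀ φ ∈ S.succ, φ.VarsBound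

/-- The individual parameter `a` does not occur in the formulas of `Γ`. -/
def Fresh (a : ℕ) (Γ : Multiset (Formula L)) : Prop := ∀ φ ∈ Γ, ¬ φ.HasPar a

/-- The `n`-ary relational parameter `A` does not occur in the formulas of `Γ`. -/
def Fresh₂ (n : ℕ+) (A : ℕ) (Γ : Multiset (Formula L)) : Prop := ∀ φ ∈ Γ, ¬ φ.HasRPar n A

open Formula

/-- All rules except Cut: `Rule ps S` says that `S` follows from the list `ps` of premises by one
application of a rule. `a` (`A`) denotes an eigenvariable, `b`, `c` (`B`, `C`) arbitrary
individual (relational) parameters. -/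
inductive Rule : List (Sequent L) → Sequent L → Prop
  -- axiom and structural rules
  | ax φ : Rule [] ({φ} ⟹ {φ})
  | weakL Γ Δ φ : Rule [Γ ⟹ Δ] (φ ::ₘ Γ ⟹ Δ)
  | weakR Γ Δ φ : Rule [Γ ⟹ Δ] (Γ ⟹ φ ::ₘ Δ)
  | contrL Γ Δ φ : Rule [φ ::ₘ φ ::ₘ Γ ⟹ Δ] (φ ::ₘ Γ ⟹ Δ)
  | contrR Γ Δ φ : Rule [Γ ⟹ φ ::ₘ φ ::ₘ Δ] (Γ ⟹ φ ::ₘ Δ)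
  -- propositional rules
  | andL Γ Δ φ ψ : Rule [φ ::ₘ ψ ::ₘ Γ ⟹ Δ] (and φ ψ ::ₘ Γ ⟹ Δ)
  | andR Γ Δ φ ψ : Rule [Γ ⟹ φ ::ₘ Δ, Γ ⟹ ψ ::ₘ Δ] (Γ ⟹ and φ ψ ::ₘ Δ)
  | negL Γ Δ φ : Rule [Γ ⟹ φ ::ₘ Δ] (neg φ ::ₘ Γ ⟹ Δ)
  | negR Γ Δ φ : Rule [φ ::ₘ Γ ⟹ Δ] (Γ ⟹ neg φ ::ₘ Δ)
  | orL Γ Δ φ ψ : Rule [φ ::ₘ Γ ⟹ Δ, ψ ::ₘ Γ ⟹ Δ] (or φ ψ ::ₘ Γ ⟹ Δ)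
  | orR Γ Δ φ ψ : Rule [Γ ⟹ φ ::ₘ ψ ::ₘ Δ] (Γ ⟹ or φ ψ ::ₘ Δ)
  | impL Γ Δ φ ψ : Rule [Γ ⟹ φ ::ₘ Δ, ψ ::ₘ Γ ⟹ Δ] (imp φ ψ ::ₘ Γ ⟹ Δ)
  | impR Γ Δ φ ψ : Rule [φ ::ₘ Γ ⟹ ψ ::ₘ Δ] (Γ ⟹ imp φ ψ ::ₘ Δ)
  | iffL Γ Δ φ ψ :
      Rule [Γ ⟹ φ ::ₘ ψ ::ₘ Δ, φ ::ₘ ψ ::ₘ Γ ⟹ Δ] (iff φ ψ ::ₘ Γ ⟹ Δ)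
  | iffR Γ Δ φ ψ :
      Rule [φ ::ₘ Γ ⟹ ψ ::ₘ Δ, ψ ::ₘ Γ ⟹ φ ::ₘ Δ] (Γ ⟹ iff φ ψ ::ₘ Δ)
  -- first-order quantifiers
  | allL Γ Δ x φ b : Rule [φ.subst x b ::ₘ Γ ⟹ Δ] (all x φ ::ₘ Γ ⟹ Δ)
  | allR Γ Δ x φ a : Fresh a Γ → Fresh a Δ → ¬ φ.HasPar a →
      Rule [Γ ⟹ φ.subst x a ::ₘ Δ] (Γ ⟹ all x φ ::ₘ Δ)
  | exL Γ Δ x φ a : Fresh a Γ → Fresh a Δ → ¬ φ.HasPar a →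
      Rule [φ.subst x a ::ₘ Γ ⟹ Δ] (ex x φ ::ₘ Γ ⟹ Δ)
  | exR Γ Δ x φ b : Rule [Γ ⟹ φ.subst x b ::ₘ Δ] (Γ ⟹ ex x φ ::ₘ Δ)
  -- first-order identity
  | eqPlus Γ Δ b : Rule [eq (.par b) (.par b) ::ₘ Γ ⟹ Δ] (Γ ⟹ Δ)
  | eqMinus Γ Δ x b c (φ : Formula L) : φ.IsAtomic →
      Rule [φ.subst x c ::ₘ Γ ⟹ Δ] (eq (.par b) (.par c) ::ₘ φ.subst x b ::ₘ Γ ⟹ Δ)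
  -- first-order lambda atoms and descriptions
  | lamL Γ Δ x ψ b : Rule [ψ.subst x b ::ₘ Γ ⟹ Δ] (lam x ψ (.par b) ::ₘ Γ ⟹ Δ)
  | lamR Γ Δ x ψ b : Rule [Γ ⟹ ψ.subst x b ::ₘ Δ] (Γ ⟹ lam x ψ (.par b) ::ₘ Δ)
  | iotaL₁ Γ Δ x ψ y φ a : Fresh a Γ → Fresh a Δ → ¬ φ.HasPar a → ¬ ψ.HasPar a →
      Rule [φ.subst y a ::ₘ ψ.subst x a ::ₘ Γ ⟹ Δ] (lamIota x ψ y φ ::ₘ Γ ⟹ Δ)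
  | iotaL₂ Γ Δ x ψ y φ b c :
      Rule [Γ ⟹ φ.subst y b ::ₘ Δ, Γ ⟹ φ.subst y c ::ₘ Δ, eq (.par b) (.par c) ::ₘ Γ ⟹ Δ]
        (lamIota x ψ y φ ::ₘ Γ ⟹ Δ)
  | iotaR Γ Δ x ψ y φ b a : Fresh a Γ → Fresh a Δ → ¬ φ.HasPar a → a ≠ b →
      Rule [Γ ⟹ φ.subst y b ::ₘ Δ, Γ ⟹ ψ.subst x b ::ₘ Δ,
          φ.subst y a ::ₘ Γ ⟹ eq (.par a) (.par b) ::ₘ Δ]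
        (Γ ⟹ lamIota x ψ y φ ::ₘ Δ)
  -- second-order identity
  | relEqL Γ Δ (n : ℕ+) (X Y : RTerm L n) (b : Fin n → ℕ) :
      Rule [Γ ⟹ rel X (fun i => .par (b i)) ::ₘ rel Y (fun i => .par (b i)) ::ₘ Δ,
          rel X (fun i => .par (b i)) ::ₘ rel Y (fun i => .par (b i)) ::ₘ Γ ⟹ Δ]
        (relEq X Y ::ₘ Γ ⟹ Δ)
  | relEqR Γ Δ (n : ℕ+) (X Y : RTerm L n) (a : Fin n → ℕ) : Function.Injective a →
      (∀ i, Fresh (a i) Γ) → (∀ i, Fresh (a i) Δ) →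
      Rule [rel X (fun i => .par (a i)) ::ₘ Γ ⟹ rel Y (fun i => .par (a i)) ::ₘ Δ,
          rel Y (fun i => .par (a i)) ::ₘ Γ ⟹ rel X (fun i => .par (a i)) ::ₘ Δ]
        (Γ ⟹ relEq X Y ::ₘ Δ)
  -- second-order quantifiers
  | allL₂ Γ Δ n X φ B : Rule [φ.subst₂ n X B ::ₘ Γ ⟹ Δ] (all₂ n X φ ::ₘ Γ ⟹ Δ)
  | allR₂ Γ Δ n X φ A : Fresh₂ n A Γ → Fresh₂ n A Δ → ¬ φ.HasRPar n A →
      Rule [Γ ⟹ φ.subst₂ n X A ::ₘ Δ] (Γ ⟹ all₂ n X φ ::ₘ Δ)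
  | exL₂ Γ Δ n X φ A : Fresh₂ n A Γ → Fresh₂ n A Δ → ¬ φ.HasRPar n A →
      Rule [φ.subst₂ n X A ::ₘ Γ ⟹ Δ] (ex₂ n X φ ::ₘ Γ ⟹ Δ)
  | exR₂ Γ Δ n X φ B : Rule [Γ ⟹ φ.subst₂ n X B ::ₘ Δ] (Γ ⟹ ex₂ n X φ ::ₘ Δ)
  -- second-order descriptions
  | iotaL₁₂ Γ Δ n X ψ Y φ A :
      Fresh₂ n A Γ → Fresh₂ n A Δ → ¬ φ.HasRPar n A → ¬ ψ.HasRPar n A →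
      Rule [φ.subst₂ n Y A ::ₘ ψ.subst₂ n X A ::ₘ Γ ⟹ Δ] (lamIota₂ n X ψ Y φ ::ₘ Γ ⟹ Δ)
  | iotaL₂₂ Γ Δ n X ψ Y φ B C :
      Rule [Γ ⟹ φ.subst₂ n Y B ::ₘ Δ, Γ ⟹ φ.subst₂ n Y C ::ₘ Δ,
          relEq (n := n) (.par B) (.par C) ::ₘ Γ ⟹ Δ]
        (lamIota₂ n X ψ Y φ ::ₘ Γ ⟹ Δ)
  | iotaR₂ Γ Δ n X ψ Y φ B A :
      Fresh₂ n A Γ → Fresh₂ n A Δ → ¬ φ.HasRPar n A → A ≠ B →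
      Rule [Γ ⟹ φ.subst₂ n Y B ::ₘ Δ, Γ ⟹ ψ.subst₂ n X B ::ₘ Δ,
          φ.subst₂ n Y A ::ₘ Γ ⟹ relEq (n := n) (.par A) (.par B) ::ₘ Δ]
        (Γ ⟹ lamIota₂ n X ψ Y φ ::ₘ Δ)

/-- The Cut rule. -/
inductive CutRule : List (Sequent L) → Sequent L → Prop
  | cut Γ Δ Pi Sg φ : CutRule [Γ ⟹ φ ::ₘ Δ, φ ::ₘ Pi ⟹ Sg] (Γ + Pi ⟹ Δ + Sg)

/-- `Derivable R S`: there is a finite tree of sequents with root `S` each of whose nodes follows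
from its immediate predecessors by `R` (leaves are conclusions of `R` without premises). -/
inductive Derivable (R : List (Sequent L) → Sequent L → Prop) : Sequent L → Prop
  | node (ps : List (Sequent L)) (S : Sequent L) :
      R ps S → (∀ P ∈ ps, Derivable R P) → Derivable R S

/-- There is a derivation in RLL, Cut allowed. -/
def Provable (S : Sequent L) : Prop :=
  Derivable (fun ps T => Rule ps T ∨ CutRule ps T) S

/-- There is a cut-free derivation in RLL. -/
def CutFreeProvable (S : Sequent L) : Prop :=
  Derivable Rule S

/-- There is a derivation in RLL, Cut allowed, in whose sequents no variable occurs free. -/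
def ProvableBound (S : Sequent L) : Prop :=
  Derivable (fun ps T => (Rule ps T ∨ CutRule ps T) ∧ T.VarsBound) S

/-- There is a cut-free derivation in RLL in whose sequents no variable occurs free. -/
def CutFreeProvableBound (S : Sequent L) : Prop :=
  Derivable (fun ps T => Rule ps T ∧ T.VarsBound) S

end RLL

namespace RLL

universe u

variable {L : Signature.{u}}

/-! Cut is eliminated in an auxiliary calculus, `Der`, from which eigenvariables and structural
rules have been removed. A rule with an eigenvariable gets instead one premise for every parameter,
as in an ω-rule. Principal formulas stay in the premises, and contexts are only tested for
membership, so weakening and contraction are built in (`Der.weaken`).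

A derivation with Cut is translated together with all its parameter renamings (`Provable.der`).
Redirecting an eigenvariable to `b` leaves the context unchanged and yields the premise for `b`. Cut
goes to cut in `Der`, which is admissible (`cuttable`) by induction on the degree of the cut
formula. `Reducible.cut` walks up the left derivation and `Reducible.cut_principal` the right one,
until the formula is principal on both sides; then `reducible_of_cuttable` replaces the cut by cuts
of smaller degree. No substitution lemma is needed here, because the required instance is already
among the premises. Quantifiers are instantiated by parameters only, even at second order, so the
degree of an instance does not grow.

Conversely, `Der.cutFreeProvable` keeps just one premise of each infinite family, that of a fresh
parameter, and contracts the retained principal formula.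

The version without free variables follows from the first: read upwards, rules other than Cut
introduce no free variable (`Rule.varsBound`), so any cut-free derivation of a sequent without free
variables has none anywhere. -/

/-! ### Renaming of parameters -/

/-- Rename the individual parameters of a term. -/
def Term.ren (f : ℕ → ℕ) : Term L → Term L
  | .var x => .var x
  | .par a => .par (f a)
  | .con k => .con k

/-- Rename the relational parameters. -/
def RTerm.ren (F : ℕ+ → ℕ → ℕ) {n : ℕ+} : RTerm L n → RTerm L n
  | .var X => .var X
  | .par A => .par (F n A)
  | .con K => .con K

namespace Formula

/-- Rename the individual parameters of a formula by `f` and the relational ones by `F`. -/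
def ren (f : ℕ → ℕ) (F : ℕ+ → ℕ → ℕ) : Formula L → Formula L
  | eq s t => eq (s.ren f) (t.ren f)
  | pred P ts => pred P (fun i => (ts i).ren f)
  | relEq X Y => relEq (X.ren F) (Y.ren F)
  | rel X ts => rel (X.ren F) (fun i => (ts i).ren f)
  | neg φ => neg (φ.ren f F)
  | and φ ψ => and (φ.ren f F) (ψ.ren f F)
  | or φ ψ => or (φ.ren f F) (ψ.ren f F)
  | imp φ ψ => imp (φ.ren f F) (ψ.ren f F)
  | iff φ ψ => iff (φ.ren f F) (ψ.ren f F)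
  | all x φ => all x (φ.ren f F)
  | ex x φ => ex x (φ.ren f F)
  | all₂ n X φ => all₂ n X (φ.ren f F)
  | ex₂ n X φ => ex₂ n X (φ.ren f F)
  | lam x ψ t => lam x (ψ.ren f F) (t.ren f)
  | lamIota x ψ y φ => lamIota x (ψ.ren f F) y (φ.ren f F)
  | lamIota₂ n X ψ Y φ => lamIota₂ n X (ψ.ren f F) Y (φ.ren f F)

theorem _root_.RLL.Term.ren_subst (f : ℕ → ℕ) (x b : ℕ) (t : Term L) :
    (t.subst x b).ren f = (t.ren f).subst x (f b) := by
  cases t <;> simp only [Term.subst, Term.ren]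
  split_ifs <;> rfl

theorem _root_.RLL.RTerm.ren_subst (F : ℕ+ → ℕ → ℕ) (n : ℕ+) (X B : ℕ) {m : ℕ+}
    (t : RTerm L m) : (t.subst n X B).ren F = (t.ren F).subst n X (F n B) := by
  cases t <;> simp only [RTerm.subst, RTerm.ren]
  split_ifs with h
  · obtain ⟨rfl, -⟩ := h; rfl
  · rfl

theorem ren_subst (f : ℕ → ℕ) (F : ℕ+ → ℕ → ℕ) (x b : ℕ) (φ : Formula L) :
    (φ.subst x b).ren f F = (φ.ren f F).subst x (f b) := by
  induction φ <;> simp only [subst, ren, Term.ren_subst, *] <;> (try split_ifs) <;> simp [*]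

theorem ren_subst₂ (f : ℕ → ℕ) (F : ℕ+ → ℕ → ℕ) (n : ℕ+) (X B : ℕ) (φ : Formula L) :
    (φ.subst₂ n X B).ren f F = (φ.ren f F).subst₂ n X (F n B) := by
  induction φ <;> simp only [subst₂, ren, RTerm.ren_subst, *] <;> (try split_ifs) <;> simp [*]

theorem _root_.RLL.Term.ren_congr {f g : ℕ → ℕ} (t : Term L)
    (h : ∀ a, t = .par a → f a = g a) : t.ren f = t.ren g := by
  cases t <;> simp_all [Term.ren]

theorem _root_.RLL.RTerm.ren_congr {F G : ℕ+ → ℕ → ℕ} {n : ℕ+} (t : RTerm L n)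
    (h : ∀ A, t = .par A → F n A = G n A) : t.ren F = t.ren G := by
  cases t <;> simp_all [RTerm.ren]

/-- A renaming only matters on the parameters that occur. -/
theorem ren_congr {f g : ℕ → ℕ} {F G : ℕ+ → ℕ → ℕ} (φ : Formula L)
    (h : ∀ a, φ.HasPar a → f a = g a) (h₂ : ∀ n A, φ.HasRPar n A → F n A = G n A) :
    φ.ren f F = φ.ren g G := by
  induction φ with
  | eq s t =>
    simp only [ren]
    rw [Term.ren_congr s fun a e => h a (Or.inl e), Term.ren_congr t fun a e => h a (Or.inr e)]
  | pred P ts =>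
    simp only [ren]
    congr 1; funext i
    exact Term.ren_congr _ fun a e => h a ⟨i, e⟩
  | relEq X Y =>
    simp only [ren]
    rw [RTerm.ren_congr X fun a e => h₂ _ a ⟨rfl, Or.inl e⟩,
      RTerm.ren_congr Y fun a e => h₂ _ a ⟨rfl, Or.inr e⟩]
  | rel X ts =>
    simp only [ren]
    rw [RTerm.ren_congr X fun a e => h₂ _ a ⟨rfl, e⟩]
    congr 1; funext i
    exact Term.ren_congr _ fun a e => h a ⟨i, e⟩
  | lam x ψ t ih =>
    simp only [ren]
    rw [ih (fun a e => h a (Or.inl e)) h₂, Term.ren_congr t fun a e => h a (Or.inr e)]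
  | neg φ ih | all _ φ ih | ex _ φ ih | all₂ _ _ φ ih | ex₂ _ _ φ ih =>
    simp only [ren]
    rw [ih h h₂]
  | and φ ψ ih ihψ | or φ ψ ih ihψ | imp φ ψ ih ihψ | iff φ ψ ih ihψ | lamIota _ φ _ ψ ih ihψ
  | lamIota₂ _ _ φ _ ψ ih ihψ =>
    simp only [ren]
    rw [ih (fun a e => h a (Or.inl e)) fun n A e => h₂ n A (Or.inl e),
      ihψ (fun a e => h a (Or.inr e)) fun n A e => h₂ n A (Or.inr e)]

theorem ren_id (φ : Formula L) : φ.ren id (fun _ => id) = φ := by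
  have ht : ∀ t : Term L, t.ren id = t := fun t => by cases t <;> rfl
  have hr : ∀ (n : ℕ+) (t : RTerm L n), t.ren (fun _ => id) = t := fun n t => by cases t <;> rfl
  induction φ <;> simp [ren, *]

theorem IsAtomic.ren {f : ℕ → ℕ} {F : ℕ+ → ℕ → ℕ} {φ : Formula L} (h : φ.IsAtomic) :
    (φ.ren f F).IsAtomic := by
  cases φ <;> simp_all [IsAtomic, Formula.ren]

/-! ### Degree -/

/-- The degree of a formula. Identities of relations weigh more than the atoms they reduce to. -/
def deg : Formula L → ℕ
  | eq _ _ => 0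
  | pred _ _ => 0
  | relEq _ _ => 1
  | rel _ _ => 0
  | neg φ => φ.deg + 1
  | and φ ψ => φ.deg + ψ.deg + 1
  | or φ ψ => φ.deg + ψ.deg + 1
  | imp φ ψ => φ.deg + ψ.deg + 1
  | iff φ ψ => φ.deg + ψ.deg + 1
  | all _ φ => φ.deg + 1
  | ex _ φ => φ.deg + 1
  | all₂ _ _ φ => φ.deg + 1
  | ex₂ _ _ φ => φ.deg + 1
  | lam _ ψ _ => ψ.deg + 1
  | lamIota _ ψ _ φ => ψ.deg + φ.deg + 2
  | lamIota₂ _ _ ψ _ φ => ψ.deg + φ.deg + 2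

@[simp] theorem deg_subst (x b : ℕ) (φ : Formula L) : (φ.subst x b).deg = φ.deg := by
  induction φ <;> simp only [subst, deg] <;> (try split_ifs) <;> simp [*]

-- A relational variable is replaced by a parameter, never by a formula. This predicativity is what
-- lets induction on the degree handle the second-order quantifiers.
@[simp] theorem deg_subst₂ (n : ℕ+) (X B : ℕ) (φ : Formula L) :
    (φ.subst₂ n X B).deg = φ.deg := by
  induction φ <;> simp only [subst₂, deg] <;> (try split_ifs) <;> simp [*]

/-! ### Only finitely many parameters occur in a formula -/

theorem finite_hasPar (φ : Formula L) : {a | φ.HasPar a}.Finite := by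
  have ht : ∀ t : Term L, {a | t = .par a}.Finite := fun t =>
    Set.Subsingleton.finite fun a ha b hb => Term.par.inj (ha.symm.trans hb)
  induction φ with
  | eq s t => exact (ht s).union (ht t)
  | pred P ts | rel X ts =>
    simp only [HasPar, Set.ofPred_exists]
    exact Set.finite_iUnion fun i => ht (ts i)
  | relEq X Y => simp [HasPar]
  | lam x ψ t ih => exact ih.union (ht t)
  | neg φ ih | all _ φ ih | ex _ φ ih | all₂ _ _ φ ih | ex₂ _ _ φ ih => exact ih
  | and φ ψ ih ihψ | or φ ψ ih ihψ | imp φ ψ ih ihψ | iff φ ψ ih ihψ | lamIota _ φ _ ψ ih ihψ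
  | lamIota₂ _ _ φ _ ψ ih ihψ => exact ih.union ihψ

theorem finite_hasRPar (n : ℕ+) (φ : Formula L) : {A | φ.HasRPar n A}.Finite := by
  have ht : ∀ (m : ℕ+) (t : RTerm L m), {A | t = .par A}.Finite := fun m t =>
    Set.Subsingleton.finite fun a ha b hb => RTerm.par.inj (ha.symm.trans hb)
  induction φ with
  | eq s t | pred P ts => simp [HasRPar]
  | rel X ts => exact (ht _ X).subset fun a ha => ha.2
  | relEq X Y => exact ((ht _ X).union (ht _ Y)).subset fun a ha => ha.2
  | lam x ψ t ih => exact ih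
  | neg φ ih | all _ φ ih | ex _ φ ih | all₂ _ _ φ ih | ex₂ _ _ φ ih => exact ih
  | and φ ψ ih ihψ | or φ ψ ih ihψ | imp φ ψ ih ihψ | iff φ ψ ih ihψ | lamIota _ φ _ ψ ih ihψ
  | lamIota₂ _ _ φ _ ψ ih ihψ => exact ih.union ihψ

/-! ### Free variables and substitution -/

theorem _root_.RLL.Term.subst_eq_var {x b y : ℕ} {t : Term L} :
    t.subst x b = .var y ↔ y ≠ x ∧ t = .var y := by
  cases t <;> simp only [Term.subst] <;> (try split_ifs) <;> grind

theorem _root_.RLL.RTerm.subst_eq_var {n m : ℕ+} {X B Y : ℕ} {t : RTerm L m} :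
    t.subst n X B = .var Y ↔ ¬(m = n ∧ Y = X) ∧ t = .var Y := by
  cases t <;> simp only [RTerm.subst] <;> (try split_ifs) <;> grind

theorem freeVar_subst {x b y : ℕ} {φ : Formula L} :
    (φ.subst x b).FreeVar y ↔ y ≠ x ∧ φ.FreeVar y := by
  induction φ <;> simp only [subst, FreeVar, Term.subst_eq_var] <;> (try split_ifs) <;> grind

theorem freeRVar_subst {x b : ℕ} {n : ℕ+} {Y : ℕ} {φ : Formula L} :
    (φ.subst x b).FreeRVar n Y ↔ φ.FreeRVar n Y := by
  induction φ <;> simp only [subst, FreeRVar] <;> (try split_ifs) <;> grind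

theorem freeVar_subst₂ {n : ℕ+} {X B y : ℕ} {φ : Formula L} :
    (φ.subst₂ n X B).FreeVar y ↔ φ.FreeVar y := by
  induction φ <;> simp only [subst₂, FreeVar] <;> (try split_ifs) <;> grind

theorem freeRVar_subst₂ {n m : ℕ+} {X B Y : ℕ} {φ : Formula L} :
    (φ.subst₂ n X B).FreeRVar m Y ↔ ¬(m = n ∧ Y = X) ∧ φ.FreeRVar m Y := by
  induction φ <;> simp only [subst₂, FreeRVar, RTerm.subst_eq_var] <;> (try split_ifs) <;> grind

end Formula

open Formula

theorem finite_not_fresh (Γ : Multiset (Formula L)) : {a | ¬ Fresh a Γ}.Finite := by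
  have : {a | ¬ Fresh a Γ} = ⋃ φ ∈ {φ | φ ∈ Γ}, {a | φ.HasPar a} := by
    ext a; simp [Fresh]
  rw [this]
  exact (Multiset.finite_toSet Γ).biUnion fun φ _ => φ.finite_hasPar

theorem finite_not_fresh₂ (n : ℕ+) (Γ : Multiset (Formula L)) : {A | ¬ Fresh₂ n A Γ}.Finite := by
  have : {A | ¬ Fresh₂ n A Γ} = ⋃ φ ∈ {φ | φ ∈ Γ}, {A | φ.HasRPar n A} := by
    ext a; simp [Fresh₂]
  rw [this]
  exact (Multiset.finite_toSet Γ).biUnion fun φ _ => φ.finite_hasRPar n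

theorem exists_fresh (Γ : Multiset (Formula L)) : ∃ a, Fresh a Γ := by
  obtain ⟨a, ha⟩ := (finite_not_fresh Γ).exists_notMem
  exact ⟨a, by simpa using ha⟩

theorem exists_fresh₂ (n : ℕ+) (Γ : Multiset (Formula L)) : ∃ A, Fresh₂ n A Γ := by
  obtain ⟨a, ha⟩ := (finite_not_fresh₂ n Γ).exists_notMem
  exact ⟨a, by simpa using ha⟩

/-- The fresh parameters form a cofinite, hence infinite, set. This supplies the eigenvariables for
an identity of `n`-ary relations on the right. -/
theorem exists_injective_fresh (n : ℕ) (Γ : Multiset (Formula L)) :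
    ∃ a : Fin n → ℕ, Function.Injective a ∧ ∀ i, Fresh (a i) Γ := by
  have hi : {a | Fresh a Γ}.Infinite := by
    have := (finite_not_fresh Γ).infinite_compl
    simpa [Set.compl_ofPred] using this
  exact ⟨fun i => hi.natEmbedding _ i,
    fun i j h => Fin.ext ((hi.natEmbedding _).injective (Subtype.ext h)),
    fun i => (hi.natEmbedding _ i).2⟩

@[simp] theorem fresh_cons {a : ℕ} {φ : Formula L} {Γ : Multiset (Formula L)} :
    Fresh a (φ ::ₘ Γ) ↔ ¬ φ.HasPar a ∧ Fresh a Γ := by simp [Fresh]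

@[simp] theorem fresh_add {a : ℕ} {Γ Δ : Multiset (Formula L)} :
    Fresh a (Γ + Δ) ↔ Fresh a Γ ∧ Fresh a Δ := by simp [Fresh, or_imp, forall_and]

@[simp] theorem fresh₂_cons {n : ℕ+} {a : ℕ} {φ : Formula L} {Γ : Multiset (Formula L)} :
    Fresh₂ n a (φ ::ₘ Γ) ↔ ¬ φ.HasRPar n a ∧ Fresh₂ n a Γ := by simp [Fresh₂]

@[simp] theorem fresh₂_add {n : ℕ+} {a : ℕ} {Γ Δ : Multiset (Formula L)} :
    Fresh₂ n a (Γ + Δ) ↔ Fresh₂ n a Γ ∧ Fresh₂ n a Δ := by simp [Fresh₂, or_imp, forall_and]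

/-! ### A cumulative calculus without eigenvariables -/

/-- What a premise adds to the antecedent and to the succedent. -/
abbrev Premise (L : Signature.{u}) := Multiset (Formula L) × Multiset (Formula L)

/-- The atom `X(b₁,…,bₙ)` for parameters `b₁,…,bₙ`. -/
abbrev atom {n : ℕ+} (X : RTerm L n) (b : Fin n → ℕ) : Formula L := .rel X fun i => .par (b i)

/-- `RightPrem φ I`: the succedent formula `φ` can be inferred from the premises `I`. Instead of
one premise with an eigenvariable there is a premise for every parameter. -/
inductive RightPrem : Formula L → Set (Premise L) → Prop
  | neg φ : RightPrem (.neg φ) {({φ}, 0)}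
  | and φ ψ : RightPrem (.and φ ψ) {(0, {φ}), (0, {ψ})}
  | or φ ψ : RightPrem (.or φ ψ) {(0, {φ, ψ})}
  | imp φ ψ : RightPrem (.imp φ ψ) {({φ}, {ψ})}
  | iff φ ψ : RightPrem (.iff φ ψ) {({φ}, {ψ}), ({ψ}, {φ})}
  | all x φ : RightPrem (.all x φ) (Set.range fun a => (0, {φ.subst x a}))
  | ex x φ b : RightPrem (.ex x φ) {(0, {φ.subst x b})}
  | all₂ n X φ : RightPrem (.all₂ n X φ) (Set.range fun A => (0, {φ.subst₂ n X A}))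
  | ex₂ n X φ B : RightPrem (.ex₂ n X φ) {(0, {φ.subst₂ n X B})}
  | lam x ψ b : RightPrem (.lam x ψ (.par b)) {(0, {ψ.subst x b})}
  | lamIota x ψ y φ b : RightPrem (.lamIota x ψ y φ)
      (insert (0, {φ.subst y b}) (insert (0, {ψ.subst x b})
        (Set.range fun a => ({φ.subst y a}, {.eq (.par a) (.par b)}))))
  | relEq {n : ℕ+} (X Y : RTerm L n) : RightPrem (.relEq X Y)
      (Set.range (fun a => ({atom X a}, {atom Y a})) ∪
        Set.range fun a => ({atom Y a}, {atom X a}))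
  | lamIota₂ n X ψ Y φ B : RightPrem (.lamIota₂ n X ψ Y φ)
      (insert (0, {φ.subst₂ n Y B}) (insert (0, {ψ.subst₂ n X B})
        (Set.range fun A => ({φ.subst₂ n Y A}, {.relEq (n := n) (.par A) (.par B)}))))

/-- `LeftPrem φ I`: the antecedent formula `φ` can be inferred from the premises `I`. -/
inductive LeftPrem : Formula L → Set (Premise L) → Prop
  | neg φ : LeftPrem (.neg φ) {(0, {φ})}
  | and φ ψ : LeftPrem (.and φ ψ) {({φ, ψ}, 0)}
  | or φ ψ : LeftPrem (.or φ ψ) {({φ}, 0), ({ψ}, 0)}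
  | imp φ ψ : LeftPrem (.imp φ ψ) {(0, {φ}), ({ψ}, 0)}
  | iff φ ψ : LeftPrem (.iff φ ψ) {(0, {φ, ψ}), ({φ, ψ}, 0)}
  | all x φ b : LeftPrem (.all x φ) {({φ.subst x b}, 0)}
  | ex x φ : LeftPrem (.ex x φ) (Set.range fun a => ({φ.subst x a}, 0))
  | all₂ n X φ B : LeftPrem (.all₂ n X φ) {({φ.subst₂ n X B}, 0)}
  | ex₂ n X φ : LeftPrem (.ex₂ n X φ) (Set.range fun A => ({φ.subst₂ n X A}, 0))
  | lam x ψ b : LeftPrem (.lam x ψ (.par b)) {({ψ.subst x b}, 0)}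
  | lamIota x ψ y φ : LeftPrem (.lamIota x ψ y φ)
      (Set.range fun a => ({φ.subst y a, ψ.subst x a}, 0))
  | lamIota_eq x ψ y φ b c : LeftPrem (.lamIota x ψ y φ)
      {(0, {φ.subst y b}), (0, {φ.subst y c}), ({.eq (.par b) (.par c)}, 0)}
  | relEq {n : ℕ+} (X Y : RTerm L n) b : LeftPrem (.relEq X Y)
      {(0, {atom X b, atom Y b}), ({atom X b, atom Y b}, 0)}
  | lamIota₂ n X ψ Y φ : LeftPrem (.lamIota₂ n X ψ Y φ)
      (Set.range fun A => ({φ.subst₂ n Y A, ψ.subst₂ n X A}, 0))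
  | lamIota₂_eq n X ψ Y φ B C : LeftPrem (.lamIota₂ n X ψ Y φ)
      {(0, {φ.subst₂ n Y B}), (0, {φ.subst₂ n Y C}), ({.relEq (n := n) (.par B) (.par C)}, 0)}

/-- Cut-free derivability with principal formulas kept in the premises. -/
inductive Der : Multiset (Formula L) → Multiset (Formula L) → Prop
  | ax {Γ Δ} φ : φ ∈ Γ → φ ∈ Δ → Der Γ Δ
  | right {Γ Δ} φ I : RightPrem φ I → φ ∈ Δ → (∀ p ∈ I, Der (p.1 + Γ) (p.2 + Δ)) → Der Γ Δ
  | left {Γ Δ} φ I : LeftPrem φ I → φ ∈ Γ → (∀ p ∈ I, Der (p.1 + Γ) (p.2 + Δ)) → Der Γ Δ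
  | eqPlus {Γ Δ} b : Der (.eq (.par b) (.par b) ::ₘ Γ) Δ → Der Γ Δ
  | eqMinus {Γ Δ} x b c (φ : Formula L) : φ.IsAtomic → (∀ I, ¬ RightPrem (φ.subst x b) I) →
      .eq (.par b) (.par c) ∈ Γ → φ.subst x b ∈ Γ → Der (φ.subst x c ::ₘ Γ) Δ → Der Γ Δ

/-- Multiset inclusion `⊆` ignores multiplicities, so this is weakening and contraction at once.
There is no freshness condition for a larger context to violate. -/
theorem Der.weaken {Γ Δ Γ' Δ' : Multiset (Formula L)} (h : Der Γ Δ) (hΓ : Γ ⊆ Γ')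
    (hΔ : Δ ⊆ Δ') : Der Γ' Δ' := by
  induction h generalizing Γ' Δ' with
  | ax φ h₁ h₂ => exact .ax φ (hΓ h₁) (hΔ h₂)
  | right φ I hI h₁ _ ih =>
    exact .right φ I hI (hΔ h₁) fun p hp => ih p hp (by grind [Multiset.subset_iff])
      (by grind [Multiset.subset_iff])
  | left φ I hI h₁ _ ih =>
    exact .left φ I hI (hΓ h₁) fun p hp => ih p hp (by grind [Multiset.subset_iff])
      (by grind [Multiset.subset_iff])
  | eqPlus b _ ih => exact .eqPlus b (ih (Multiset.cons_subset_cons hΓ) hΔ)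
  | eqMinus x b c φ ha hn h₁ h₂ _ ih =>
    exact .eqMinus x b c φ ha hn (hΓ h₁) (hΓ h₂) (ih (Multiset.cons_subset_cons hΓ) hΔ)

/-! ### Admissibility of cut in the cumulative calculus -/

/-- Principal cuts on `φ` can be removed. -/
def Reducible (φ : Formula L) : Prop :=
  ∀ I J Γ Δ, RightPrem φ I → LeftPrem φ J → (∀ p ∈ I, Der (p.1 + Γ) (p.2 + Δ)) →
    (∀ p ∈ J, Der (p.1 + Γ) (p.2 + Δ)) → Der Γ Δ

/-- Cuts on `φ` are admissible. -/
def Cuttable (φ : Formula L) : Prop :=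
  ∀ Γ Δ, Der Γ (φ ::ₘ Δ) → Der (φ ::ₘ Γ) Δ → Der Γ Δ

/-- Induction on the right derivation, with `φ` already principal on the left. The premises `I` are
carried along, weakened to the growing context, until `φ` becomes principal on the right too. The
inclusions `hΓ`, `hΔ` let the induction hypothesis absorb the retained copies of `φ`. -/
theorem Reducible.cut_principal {φ : Formula L} (hφ : Reducible φ) {I : Set (Premise L)}
    (hI : RightPrem φ I) {Γ₂ Δ₂ Γ Δ : Multiset (Formula L)} (h : Der Γ₂ Δ₂)
    (hΓ : Γ₂ ⊆ φ ::ₘ Γ) (hΔ : Δ₂ ⊆ Δ) (hp : ∀ p ∈ I, Der (p.1 + Γ) (p.2 + Δ)) : Der Γ Δ := by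
  have mono : ∀ {Γ Δ} (A B : Multiset (Formula L)), (∀ p ∈ I, Der (p.1 + Γ) (p.2 + Δ)) →
      ∀ p ∈ I, Der (p.1 + (A + Γ)) (p.2 + (B + Δ)) := fun A B h p hp =>
    (h p hp).weaken (by grind [Multiset.subset_iff])
      (by grind [Multiset.subset_iff])
  induction h generalizing Γ Δ with
  | ax χ h₁ h₂ =>
    rcases Multiset.mem_cons.1 (hΓ h₁) with rfl | h₁
    -- The axiom uses the cut formula itself, which therefore lies in `Δ`; its right rule is applied
    -- again.
    · exact .right _ I hI (hΔ h₂) hp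
    · exact .ax χ h₁ (hΔ h₂)
  | right χ K hK h₁ _ ih =>
    exact .right χ K hK (hΔ h₁) fun p hpK => ih p hpK
      (by grind [Multiset.subset_iff])
      (by grind [Multiset.subset_iff]) (mono _ _ hp)
  | left χ K hK h₁ _ ih =>
    have ihψ : ∀ p ∈ K, Der (p.1 + Γ) (p.2 + Δ) := fun p hpK => ih p hpK
      (by grind [Multiset.subset_iff])
      (by grind [Multiset.subset_iff]) (mono _ _ hp)
    rcases Multiset.mem_cons.1 (hΓ h₁) with rfl | h₁
    · exact hφ I K Γ Δ hI hK hp ihψ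
    · exact .left χ K hK h₁ ihψ
  | eqPlus b _ ih =>
    refine .eqPlus b (ih (by grind [Multiset.subset_iff]) hΔ ?_)
    simpa using mono {.eq (.par b) (.par b)} 0 hp
  -- Neither active formula can be the cut formula: no right rule introduces an individual identity,
  -- and `hn` excludes one for the replaced atom.
  | eqMinus x b c χ ha hn h₁ h₂ _ ih =>
    have h₁ : Formula.eq (.par b) (.par c) ∈ Γ := by
      rcases Multiset.mem_cons.1 (hΓ h₁) with rfl | h₁
      · cases hI
      · exact h₁
    have h₂ : χ.subst x b ∈ Γ := by
      rcases Multiset.mem_cons.1 (hΓ h₂) with rfl | h₂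
      · exact absurd hI (hn I)
      · exact h₂
    refine .eqMinus x b c χ ha hn h₁ h₂
      (ih (by grind [Multiset.subset_iff]) hΔ ?_)
    simpa using mono {χ.subst x c} 0 hp

/-- Induction on the left derivation, with the right premise weakened along the way. A cut formula
without a right rule can only be met in an axiom, and then it is already in `Γ`. -/
theorem Reducible.cut {φ : Formula L} (hφ : Reducible φ) {Γ₁ Δ₁ Γ Δ : Multiset (Formula L)}
    (h : Der Γ₁ Δ₁) (hΓ : Γ₁ ⊆ Γ) (hΔ : Δ₁ ⊆ φ ::ₘ Δ) (hr : Der (φ ::ₘ Γ) Δ) : Der Γ Δ := by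
  have mono : ∀ {Γ Δ} (A B : Multiset (Formula L)), Der (φ ::ₘ Γ) Δ →
      Der (φ ::ₘ (A + Γ)) (B + Δ) := fun A B h =>
    h.weaken (by grind [Multiset.subset_iff])
      (by grind [Multiset.subset_iff])
  induction h generalizing Γ Δ with
  | ax χ h₁ h₂ =>
    rcases Multiset.mem_cons.1 (hΔ h₂) with rfl | h₂
    · exact hr.weaken (Multiset.cons_subset.2 ⟨hΓ h₁, fun _ h => h⟩) fun _ h => h
    · exact .ax χ (hΓ h₁) h₂
  | right χ K hK h₁ _ ih =>
    -- The copy of `φ` kept in the premises is cut away first, so that they have the form required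
    -- by `Reducible.cut_principal`.
    have ihψ : ∀ p ∈ K, Der (p.1 + Γ) (p.2 + Δ) := fun p hpK => ih p hpK
      (by grind [Multiset.subset_iff])
      (by grind [Multiset.subset_iff]) (mono _ _ hr)
    rcases Multiset.mem_cons.1 (hΔ h₁) with rfl | h₁
    · exact hφ.cut_principal hK hr (fun _ h => h) (fun _ h => h) ihψ
    · exact .right χ K hK h₁ ihψ
  | left χ K hK h₁ _ ih =>
    exact .left χ K hK (hΓ h₁) fun p hpK => ih p hpK
      (by grind [Multiset.subset_iff])
      (by grind [Multiset.subset_iff]) (mono _ _ hr)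
  | eqPlus b _ ih =>
    refine .eqPlus b (ih (Multiset.cons_subset_cons hΓ) hΔ ?_)
    simpa using mono {.eq (.par b) (.par b)} 0 hr
  | eqMinus x b c χ ha hn h₁ h₂ _ ih =>
    refine .eqMinus x b c χ ha hn (hΓ h₁) (hΓ h₂) (ih (Multiset.cons_subset_cons hΓ) hΔ ?_)
    simpa using mono {χ.subst x c} 0 hr

theorem Reducible.cuttable {φ : Formula L} (hφ : Reducible φ) : Cuttable φ :=
  fun _ _ h hr => hφ.cut h (fun _ h => h) (fun _ h => h) hr

/-- Cut with arbitrary subcontexts. -/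
theorem Cuttable.mk {φ : Formula L} (hφ : Cuttable φ) {Γ Δ Γ₁ Δ₁ Γ₂ Δ₂ : Multiset (Formula L)}
    (h₁ : Der Γ₁ Δ₁) (h₂ : Der Γ₂ Δ₂)
    (hΓ₁ : Γ₁ ⊆ Γ := by grind [Multiset.subset_iff])
    (hΔ₁ : Δ₁ ⊆ φ ::ₘ Δ := by grind [Multiset.subset_iff])
    (hΓ₂ : Γ₂ ⊆ φ ::ₘ Γ := by grind [Multiset.subset_iff])
    (hΔ₂ : Δ₂ ⊆ Δ := by grind [Multiset.subset_iff]) : Der Γ Δ :=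
  hφ _ _ (h₁.weaken hΓ₁ hΔ₁) (h₂.weaken hΓ₂ hΔ₂)

theorem der_eq_of_eq_eq (b c d : ℕ) :
    Der (L := L) {.eq (.par b) (.par d), .eq (.par c) (.par d)} {.eq (.par b) (.par c)} := by
  have hn : ∀ (s t : Term L) I, ¬ RightPrem (.eq s t) I := fun s t I h => by cases h
  -- Replacement works only from left to right, so symmetry comes first: `c = d` turns `c = c` into
  -- `d = c`, which then turns `b = d` into `b = c`.
  refine .eqPlus c (.eqMinus 0 c d (.eq (.var 0) (.par c)) trivial (hn _ _) (by simp)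
    (by simp [Formula.subst, Term.subst])
    (.eqMinus 0 d c (.eq (.par b) (.var 0)) trivial (hn _ _) (by simp [Formula.subst, Term.subst])
      (by simp [Formula.subst, Term.subst])
      (.ax (.eq (.par b) (.par c)) (by simp [Formula.subst, Term.subst]) (by simp))))

/-- Extensionality reduces this to a tuple `a`. Both identities are analysed at `a`, and each branch
has one of the three atoms on both sides. -/
theorem der_relEq_of_relEq_relEq {n : ℕ+} (X Y Z : RTerm L n) :
    Der {.relEq X Z, .relEq Y Z} {.relEq X Y} := by
  refine .right _ _ (.relEq X Y) (by simp) ?_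
  rintro p (⟨a, rfl⟩ | ⟨a, rfl⟩)
  all_goals
    refine .left _ _ (.relEq X Z a) (by simp) ?_
    simp only [Set.mem_insert_iff, Set.mem_singleton_iff, forall_eq_or_imp, forall_eq]
    refine ⟨.left _ _ (.relEq Y Z a) (by simp) ?_, .left _ _ (.relEq Y Z a) (by simp) ?_⟩
    all_goals
      simp only [Set.mem_insert_iff, Set.mem_singleton_iff, forall_eq_or_imp, forall_eq]
      constructor
      all_goals first
        | (refine .ax (atom X a) ?_ ?_ <;> simp; done)
        | (refine .ax (atom Y a) ?_ ?_ <;> simp; done)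
        | (refine .ax (atom Z a) ?_ ?_ <;> simp)

/-- Cuts between the premises of an equivalence on the right and on the left. -/
theorem der_of_iff {φ ψ : Formula L} (hφ : Cuttable φ) (hψ : Cuttable ψ)
    {Γ Δ : Multiset (Formula L)} (h₁ : Der (φ ::ₘ Γ) (ψ ::ₘ Δ)) (h₂ : Der (ψ ::ₘ Γ) (φ ::ₘ Δ))
    (h₃ : Der Γ (φ ::ₘ ψ ::ₘ Δ)) (h₄ : Der (φ ::ₘ ψ ::ₘ Γ) Δ) : Der Γ Δ := by
  have kψ : Der Γ (ψ ::ₘ Δ) := hφ.mk h₃ h₁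
  have kφ : Der Γ (φ ::ₘ Δ) := hψ.mk kψ h₂
  have k : Der (ψ ::ₘ Γ) Δ := hφ.mk kφ h₄
  exact hψ.mk kψ k

/-- Cuts between the uniqueness premises of a description on the right (for two instances `β`, `γ`
of the description, yielding the identities `εβ`, `εγ`) and its premises on the left. -/
theorem der_of_unique {β γ εβ εγ ε : Formula L} (hβ : Cuttable β) (hγ : Cuttable γ)
    (hεβ : Cuttable εβ) (hεγ : Cuttable εγ) (hε : Cuttable ε) {Γ Δ : Multiset (Formula L)}
    (h₁ : Der (β ::ₘ Γ) (εβ ::ₘ Δ)) (h₂ : Der (γ ::ₘ Γ) (εγ ::ₘ Δ)) (h₃ : Der Γ (β ::ₘ Δ))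
    (h₄ : Der Γ (γ ::ₘ Δ)) (h₅ : Der (ε ::ₘ Γ) Δ) (h₆ : Der {εβ, εγ} {ε}) : Der Γ Δ := by
  have k₁ : Der Γ (εβ ::ₘ Δ) := hβ.mk h₃ h₁
  have k₂ : Der Γ (εγ ::ₘ Δ) := hγ.mk h₄ h₂
  have k₃ : Der (εβ ::ₘ εγ ::ₘ Γ) Δ := hε.mk h₆ h₅ (by simp) (by simp)
  have k₄ : Der (εγ ::ₘ Γ) Δ := hεβ.mk k₁ k₃
  exact hεγ.mk k₂ k₄

/-- Only pairs of a right and a left rule for the same connective remain. When one side is a family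
over all parameters, it is evaluated at the parameters chosen by the other side. -/
theorem reducible_of_cuttable (φ : Formula L) (ih : ∀ χ : Formula L, χ.deg < φ.deg → Cuttable χ) :
    Reducible φ := by
  intro I J Γ Δ hI hJ h₁ h₂
  cases hI <;> cases hJ <;>
    simp only [Set.mem_union, Set.mem_insert_iff, Set.mem_singleton_iff, or_imp, forall_and,
      forall_eq, Set.forall_mem_range, Multiset.insert_eq_cons, Multiset.cons_add,
      Multiset.singleton_add, zero_add] at h₁ h₂
  case neg.neg φ => exact (ih φ (by simp [deg])).mk h₂ h₁
  case and.and φ ψ =>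
    have k : Der (ψ ::ₘ Γ) Δ := (ih φ (by simp only [deg]; omega)).mk h₁.1 h₂
    exact (ih ψ (by simp only [deg]; omega)).mk h₁.2 k
  case or.or φ ψ =>
    have k : Der Γ (ψ ::ₘ Δ) := (ih φ (by simp only [deg]; omega)).mk h₁ h₂.1
    exact (ih ψ (by simp only [deg]; omega)).mk k h₂.2
  case imp.imp φ ψ =>
    have k : Der Γ (ψ ::ₘ Δ) := (ih φ (by simp only [deg]; omega)).mk h₂.1 h₁
    exact (ih ψ (by simp only [deg]; omega)).mk k h₂.2
  case iff.iff φ ψ =>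
    exact der_of_iff (ih φ (by simp only [deg]; omega)) (ih ψ (by simp only [deg]; omega))
      h₁.1 h₁.2 h₂.1 h₂.2
  case all.all b => exact ih _ (by simp [deg]) _ _ (h₁ b) h₂
  case ex.ex b => exact ih _ (by simp [deg]) _ _ h₁ (h₂ b)
  case all₂.all₂ B => exact ih _ (by simp [deg]) _ _ (h₁ B) h₂
  case ex₂.ex₂ B => exact ih _ (by simp [deg]) _ _ h₁ (h₂ B)
  case lam.lam => exact ih _ (by simp [deg]) _ _ h₁ h₂
  case lamIota.lamIota x ψ y φ b =>
    have k : Der (ψ.subst x b ::ₘ Γ) Δ :=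
      (ih (φ.subst y b) (by simp only [deg, deg_subst]; omega)).mk h₁.1 (h₂ b)
    exact (ih (ψ.subst x b) (by simp only [deg, deg_subst]; omega)).mk h₁.2.1 k
  -- The uniqueness premise at `c` and at `d` gives `c = b` and `d = b`, hence `c = d`, which the
  -- left rule refutes.
  case lamIota.lamIota_eq x ψ y φ b c d =>
    exact der_of_unique (ih _ (by simp only [deg, deg_subst]; omega))
      (ih _ (by simp only [deg, deg_subst]; omega))
      (ih _ (by simp [deg])) (ih _ (by simp [deg])) (ih _ (by simp [deg]))
      (h₁.2.2 c) (h₁.2.2 d) h₂.1 h₂.2.1 h₂.2.2 (der_eq_of_eq_eq c d b)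
  case relEq.relEq b =>
    exact der_of_iff (ih _ (by simp [deg])) (ih _ (by simp [deg])) (h₁.1 b) (h₁.2 b) h₂.1 h₂.2
  case lamIota₂.lamIota₂ n X ψ Y φ B =>
    have k : Der (ψ.subst₂ n X B ::ₘ Γ) Δ :=
      (ih (φ.subst₂ n Y B) (by simp only [deg, deg_subst₂]; omega)).mk h₁.1 (h₂ B)
    exact (ih (ψ.subst₂ n X B) (by simp only [deg, deg_subst₂]; omega)).mk h₁.2.1 k
  -- The identities cut here have degree 1, not 0. The summand 2 in the degree of a description
  -- keeps them smaller even when both bodies have degree 0.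
  case lamIota₂.lamIota₂_eq n X ψ Y φ B C D =>
    exact der_of_unique (ih _ (by simp only [deg, deg_subst₂]; omega))
      (ih _ (by simp only [deg, deg_subst₂]; omega))
      (ih _ (by simp [deg])) (ih _ (by simp [deg])) (ih _ (by simp [deg]))
      (h₁.2.2 C) (h₁.2.2 D) h₂.1 h₂.2.1 h₂.2.2 (der_relEq_of_relEq_relEq _ _ _)

theorem cuttable (φ : Formula L) : Cuttable φ := by
  induction hd : φ.deg using Nat.strong_induction_on generalizing φ with
  | _ d ih =>
    subst hd
    exact (reducible_of_cuttable φ fun χ hχ => ih _ hχ χ rfl).cuttable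

/-! ### From the calculus with Cut to the cumulative calculus -/

theorem Der.right_cons {φ : Formula L} {I : Set (Premise L)} {Γ Δ : Multiset (Formula L)}
    (hI : RightPrem φ I) (h : ∀ p ∈ I, Der (p.1 + Γ) (p.2 + Δ)) : Der Γ (φ ::ₘ Δ) :=
  .right φ I hI (by simp) fun p hp =>
    (h p hp).weaken (fun _ h => h) (by grind [Multiset.subset_iff])

theorem Der.left_cons {φ : Formula L} {I : Set (Premise L)} {Γ Δ : Multiset (Formula L)}
    (hI : LeftPrem φ I) (h : ∀ p ∈ I, Der (p.1 + Γ) (p.2 + Δ)) : Der (φ ::ₘ Γ) Δ :=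
  .left φ I hI (by simp) fun p hp =>
    (h p hp).weaken (by grind [Multiset.subset_iff]) (fun _ h => h)

/-- The side condition of `Der.eqMinus` costs nothing: the only atoms with a right rule are
identities of relations, which contain no individual terms, so that replacement leaves them
unchanged. -/
theorem Der.eqMinus_cons {x b c : ℕ} {φ : Formula L} (ha : φ.IsAtomic)
    {Γ Δ : Multiset (Formula L)} (h : Der (φ.subst x c ::ₘ Γ) Δ) :
    Der (.eq (.par b) (.par c) ::ₘ φ.subst x b ::ₘ Γ) Δ := by
  have key : (∀ I, ¬ RightPrem (φ.subst x b) I) →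
      Der (.eq (.par b) (.par c) ::ₘ φ.subst x b ::ₘ Γ) Δ := fun hn =>
    .eqMinus x b c φ ha hn (by simp) (by simp)
      (h.weaken (by grind [Multiset.subset_iff]) fun _ h => h)
  cases φ with
  | relEq X Y =>
    exact h.weaken (by simp only [Formula.subst]; grind [Multiset.subset_iff]) fun _ h => h
  | eq | pred | rel => exact key fun I hI => by simp only [Formula.subst] at hI; cases hI
  | _ => exact ha.elim

theorem Formula.ren_update {a : ℕ} {φ : Formula L} (h : ¬ φ.HasPar a) (f : ℕ → ℕ)
    (F : ℕ+ → ℕ → ℕ) (b : ℕ) : φ.ren (Function.update f a b) F = φ.ren f F :=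
  φ.ren_congr (fun c hc => Function.update_of_ne (by rintro rfl; exact h hc) _ _) fun _ _ _ => rfl

/-- Redirect the `n`-ary relational parameter `A` to `B`. -/
def updateRel (F : ℕ+ → ℕ → ℕ) (n : ℕ+) (A B : ℕ) : ℕ+ → ℕ → ℕ :=
  Function.update F n (Function.update (F n) A B)

@[simp] theorem updateRel_same (F : ℕ+ → ℕ → ℕ) (n : ℕ+) (A B : ℕ) :
    updateRel F n A B n A = B := by simp [updateRel]

theorem updateRel_of_ne (F : ℕ+ → ℕ → ℕ) {n m : ℕ+} {A C : ℕ} (B : ℕ) (h : ¬(m = n ∧ C = A)) :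
    updateRel F n A B m C = F m C := by
  by_cases hm : m = n
  · subst hm
    simp [updateRel, Function.update_of_ne (fun e => h ⟨rfl, e⟩ : C ≠ A)]
  · simp [updateRel, Function.update_of_ne hm]

theorem Formula.ren_updateRel {n : ℕ+} {A : ℕ} {φ : Formula L} (h : ¬ φ.HasRPar n A) (f : ℕ → ℕ)
    (F : ℕ+ → ℕ → ℕ) (B : ℕ) : φ.ren f (updateRel F n A B) = φ.ren f F :=
  φ.ren_congr (fun _ _ => rfl) fun m C hC =>
    updateRel_of_ne F B (by rintro ⟨rfl, rfl⟩; exact h hC)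

/-- The use of the eigenvariable condition: `a` may be sent to any `b` without disturbing the
context. -/
theorem Fresh.map_ren {a : ℕ} {Γ : Multiset (Formula L)} (h : Fresh a Γ) (f : ℕ → ℕ)
    (F : ℕ+ → ℕ → ℕ) (b : ℕ) : Γ.map (ren (Function.update f a b) F) = Γ.map (ren f F) :=
  Multiset.map_congr rfl fun φ hφ => ren_update (h φ hφ) f F b

theorem Fresh₂.map_ren {n : ℕ+} {A : ℕ} {Γ : Multiset (Formula L)} (h : Fresh₂ n A Γ)
    (f : ℕ → ℕ) (F : ℕ+ → ℕ → ℕ) (B : ℕ) :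
    Γ.map (ren f (updateRel F n A B)) = Γ.map (ren f F) :=
  Multiset.map_congr rfl fun φ hφ => ren_updateRel (h φ hφ) f F B

theorem map_ren_extend {n : ℕ} {a : Fin n → ℕ} {Γ : Multiset (Formula L)} (h : ∀ i, Fresh (a i) Γ)
    (f : ℕ → ℕ) (F : ℕ+ → ℕ → ℕ) (b : Fin n → ℕ) : Γ.map (ren (Function.extend a b f) F) = Γ.map (ren f F) :=
  Multiset.map_congr rfl fun φ hφ => φ.ren_congr (fun c hc => Function.extend_apply' _ _ _ (by
    rintro ⟨i, rfl⟩; exact h i φ hφ hc)) fun _ _ _ => rfl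

/-- Every renaming instance of a derivable sequent is derivable without Cut in the cumulative
calculus. -/
theorem Provable.der {S : Sequent L} (h : Provable S) (f : ℕ → ℕ) (F : ℕ+ → ℕ → ℕ) :
    Der (S.ante.map (ren f F)) (S.succ.map (ren f F)) := by
  induction h generalizing f F with
  | node ps S hR hps ih =>
    clear hps
    rcases hR with hR | hR
    · cases hR <;> simp only [List.mem_cons, List.not_mem_nil, or_false, or_imp, forall_and,
        forall_eq, Multiset.map_cons, Multiset.map_singleton] at ih ⊢
      case ax φ => exact .ax (φ.ren f F) (by simp) (by simp)
      case weakL =>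
        exact (ih f F).weaken (by grind [Multiset.subset_iff]) (by grind [Multiset.subset_iff])
      case weakR =>
        exact (ih f F).weaken (by grind [Multiset.subset_iff]) (by grind [Multiset.subset_iff])
      case contrL =>
        exact (ih f F).weaken (by grind [Multiset.subset_iff]) (by grind [Multiset.subset_iff])
      case contrR =>
        exact (ih f F).weaken (by grind [Multiset.subset_iff]) (by grind [Multiset.subset_iff])
      case andL => exact .left_cons (.and _ _) (by simpa using ih f F)
      case andR => exact .right_cons (.and _ _) (by simpa using ⟨ih.1 f F, ih.2 f F⟩)
      case negL => exact .left_cons (.neg _) (by simpa using ih f F)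
      case negR => exact .right_cons (.neg _) (by simpa using ih f F)
      case orL => exact .left_cons (.or _ _) (by simpa using ⟨ih.1 f F, ih.2 f F⟩)
      case orR => exact .right_cons (.or _ _) (by simpa using ih f F)
      case impL => exact .left_cons (.imp _ _) (by simpa using ⟨ih.1 f F, ih.2 f F⟩)
      case impR => exact .right_cons (.imp _ _) (by simpa using ih f F)
      case iffL => exact .left_cons (.iff _ _) (by simpa using ⟨ih.1 f F, ih.2 f F⟩)
      case iffR => exact .right_cons (.iff _ _) (by simpa using ⟨ih.1 f F, ih.2 f F⟩)
      case allL b => exact .left_cons (.all _ _ (f b)) (by simpa [ren_subst] using ih f F)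
      case allR a h₁ h₂ h₃ =>
        refine .right_cons (.all _ _) (Set.forall_mem_range.2 fun b => ?_)
        -- The premise for `b` is the given premise under the renaming that sends the eigenvariable
        -- to `b`. The other eigenvariable rules are treated alike.
        simpa [ren_subst, ren_update h₃, h₁.map_ren, h₂.map_ren] using ih (Function.update f a b) F
      case exL a h₁ h₂ h₃ =>
        refine .left_cons (.ex _ _) (Set.forall_mem_range.2 fun b => ?_)
        simpa [ren_subst, ren_update h₃, h₁.map_ren, h₂.map_ren] using ih (Function.update f a b) F
      case exR b => exact .right_cons (.ex _ _ (f b)) (by simpa [ren_subst] using ih f F)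
      case eqPlus b => exact .eqPlus (f b) (ih f F)
      case eqMinus x b c φ ha =>
        have := ih f F
        rw [ren_subst] at this ⊢
        exact .eqMinus_cons ha.ren this
      case lamL b => exact .left_cons (.lam _ _ (f b)) (by simpa [ren_subst] using ih f F)
      case lamR b => exact .right_cons (.lam _ _ (f b)) (by simpa [ren_subst] using ih f F)
      case iotaL₁ a h₁ h₂ h₃ h₄ =>
        refine .left_cons (.lamIota _ _ _ _) (Set.forall_mem_range.2 fun b => ?_)
        simpa [ren_subst, ren_update h₃, ren_update h₄, h₁.map_ren, h₂.map_ren] using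
          ih (Function.update f a b) F
      case iotaL₂ b c =>
        refine .left_cons (.lamIota_eq _ _ _ _ (f b) (f c)) ?_
        simpa [ren_subst, Formula.ren, Term.ren] using
          And.intro (ih.1 f F) (And.intro (ih.2.1 f F) (ih.2.2 f F))
      case iotaR b a h₁ h₂ h₃ h₄ =>
        refine .right_cons (.lamIota _ _ _ _ (f b)) ?_
        simp only [Set.mem_insert_iff, or_imp, forall_and, forall_eq, Set.forall_mem_range]
        refine ⟨by simpa [ren_subst] using ih.1 f F, by simpa [ren_subst] using ih.2.1 f F,
          fun c => ?_⟩
        -- Since `a ≠ b`, redirecting `a` does not move the witness `b`.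
        simpa [ren_subst, ren_update h₃, h₁.map_ren, h₂.map_ren, Formula.ren, Term.ren,
          Function.update_of_ne h₄.symm] using ih.2.2 (Function.update f a c) F
      case relEqL b =>
        refine .left_cons (.relEq _ _ (fun i => f (b i))) ?_
        simpa [Formula.ren, Term.ren] using ⟨ih.1 f F, ih.2 f F⟩
      case relEqR a ha h₁ h₂ =>
        refine .right_cons (.relEq _ _) ?_
        simp only [Set.mem_union, or_imp, forall_and, Set.forall_mem_range]
        refine ⟨fun b => ?_, fun b => ?_⟩
        -- Distinctness of the eigenvariables allows them to be sent to an arbitrary tuple `b`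
        -- simultaneously.
        · simpa [Formula.ren, Term.ren, ha.extend_apply, map_ren_extend h₁,
            map_ren_extend h₂] using ih.1 (Function.extend a b f) F
        · simpa [Formula.ren, Term.ren, ha.extend_apply, map_ren_extend h₁,
            map_ren_extend h₂] using ih.2 (Function.extend a b f) F
      case allL₂ n _ _ B =>
        exact .left_cons (.all₂ _ _ _ (F n B)) (by simpa [ren_subst₂] using ih f F)
      case allR₂ n _ _ A h₁ h₂ h₃ =>
        refine .right_cons (.all₂ _ _ _) (Set.forall_mem_range.2 fun B => ?_)
        simpa [ren_subst₂, ren_updateRel h₃, h₁.map_ren, h₂.map_ren] using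
          ih f (updateRel F n A B)
      case exL₂ n _ _ A h₁ h₂ h₃ =>
        refine .left_cons (.ex₂ _ _ _) (Set.forall_mem_range.2 fun B => ?_)
        simpa [ren_subst₂, ren_updateRel h₃, h₁.map_ren, h₂.map_ren] using
          ih f (updateRel F n A B)
      case exR₂ n _ _ B =>
        exact .right_cons (.ex₂ _ _ _ (F n B)) (by simpa [ren_subst₂] using ih f F)
      case iotaL₁₂ n _ _ _ _ A h₁ h₂ h₃ h₄ =>
        refine .left_cons (.lamIota₂ _ _ _ _ _) (Set.forall_mem_range.2 fun B => ?_)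
        simpa [ren_subst₂, ren_updateRel h₃, ren_updateRel h₄, h₁.map_ren, h₂.map_ren] using
          ih f (updateRel F n A B)
      case iotaL₂₂ n _ _ _ _ B C =>
        refine .left_cons (.lamIota₂_eq _ _ _ _ _ (F n B) (F n C)) ?_
        simpa [ren_subst₂, Formula.ren, RTerm.ren] using
          And.intro (ih.1 f F) (And.intro (ih.2.1 f F) (ih.2.2 f F))
      case iotaR₂ n _ _ _ _ B A h₁ h₂ h₃ h₄ =>
        refine .right_cons (.lamIota₂ _ _ _ _ _ (F n B)) ?_
        simp only [Set.mem_insert_iff, or_imp, forall_and, forall_eq, Set.forall_mem_range]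
        refine ⟨by simpa [ren_subst₂] using ih.1 f F, by simpa [ren_subst₂] using ih.2.1 f F,
          fun C => ?_⟩
        have hB : updateRel F n A C n B = F n B := updateRel_of_ne F C fun e => h₄ e.2.symm
        simpa [ren_subst₂, ren_updateRel h₃, h₁.map_ren, h₂.map_ren, Formula.ren, RTerm.ren,
          hB] using ih.2.2 f (updateRel F n A C)
    · cases hR with
      | cut Γ Δ Pi Sg φ =>
        simp only [List.mem_cons, List.not_mem_nil, or_false, or_imp, forall_and,
          forall_eq, Multiset.map_cons, Multiset.map_add] at ih ⊢
        exact (cuttable (φ.ren f F)).mk (ih.1 f F) (ih.2 f F)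

/-! ### From the cumulative calculus to cut-free derivations -/

namespace CutFreeProvable

variable {Γ Δ : Multiset (Formula L)} {φ : Formula L}

theorem of_rule₁ {P S : Sequent L} (h : Rule [P] S) (hP : CutFreeProvable P) :
    CutFreeProvable S :=
  .node _ _ h (by simpa [CutFreeProvable] using hP)

theorem of_rule₂ {P Q S : Sequent L} (h : Rule [P, Q] S) (hP : CutFreeProvable P)
    (hQ : CutFreeProvable Q) : CutFreeProvable S :=
  .node _ _ h (by simpa using ⟨hP, hQ⟩)

theorem of_rule₃ {P Q R S : Sequent L} (h : Rule [P, Q, R] S) (hP : CutFreeProvable P)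
    (hQ : CutFreeProvable Q) (hR : CutFreeProvable R) : CutFreeProvable S :=
  .node _ _ h (by simpa using ⟨hP, hQ, hR⟩)

theorem weaken (Γ' Δ' : Multiset (Formula L)) (h : CutFreeProvable (Γ ⟹ Δ)) :
    CutFreeProvable (Γ' + Γ ⟹ Δ' + Δ) := by
  induction Γ' using Multiset.induction with
  | empty =>
    induction Δ' using Multiset.induction with
    | empty => simpa using h
    | cons φ Δ' ih => rw [Multiset.cons_add]; exact of_rule₁ (.weakR _ _ _) ih
  | cons φ Γ' ih => rw [Multiset.cons_add]; exact of_rule₁ (.weakL _ _ _) ih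

theorem contrL (hφ : φ ∈ Γ) (h : CutFreeProvable (φ ::ₘ Γ ⟹ Δ)) : CutFreeProvable (Γ ⟹ Δ) := by
  obtain ⟨Γ, rfl⟩ := Multiset.exists_cons_of_mem hφ
  exact of_rule₁ (.contrL _ _ _) h

theorem contrR (hφ : φ ∈ Δ) (h : CutFreeProvable (Γ ⟹ φ ::ₘ Δ)) : CutFreeProvable (Γ ⟹ Δ) := by
  obtain ⟨Δ, rfl⟩ := Multiset.exists_cons_of_mem hφ
  exact of_rule₁ (.contrR _ _ _) h

/-- Of a family of premises over all parameters, the one at a fresh parameter suffices, since it is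
the premise of the original rule. This restores finite branching. -/
theorem of_rightPrem {I : Set (Premise L)} (hI : RightPrem φ I)
    (h : ∀ p ∈ I, CutFreeProvable (p.1 + Γ ⟹ p.2 + Δ)) : CutFreeProvable (Γ ⟹ φ ::ₘ Δ) := by
  cases hI <;>
    simp only [Set.mem_union, Set.mem_insert_iff, Set.mem_singleton_iff, or_imp, forall_and,
      forall_eq, Set.forall_mem_range, Multiset.insert_eq_cons, Multiset.cons_add,
      Multiset.singleton_add, zero_add] at h
  case neg => exact of_rule₁ (.negR _ _ _) h
  case and => exact of_rule₂ (.andR _ _ _ _) h.1 h.2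
  case or => exact of_rule₁ (.orR _ _ _ _) h
  case imp => exact of_rule₁ (.impR _ _ _ _) h
  case iff => exact of_rule₂ (.iffR _ _ _ _) h.1 h.2
  case all x φ =>
    obtain ⟨a, ha⟩ := exists_fresh (φ ::ₘ (Γ + Δ))
    simp only [fresh_cons, fresh_add] at ha
    exact of_rule₁ (.allR _ _ _ _ a ha.2.1 ha.2.2 ha.1) (h a)
  case ex => exact of_rule₁ (.exR _ _ _ _ _) h
  case all₂ n X φ =>
    obtain ⟨A, hA⟩ := exists_fresh₂ n (φ ::ₘ (Γ + Δ))
    simp only [fresh₂_cons, fresh₂_add] at hA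
    exact of_rule₁ (.allR₂ _ _ _ _ _ A hA.2.1 hA.2.2 hA.1) (h A)
  case ex₂ => exact of_rule₁ (.exR₂ _ _ _ _ _ _) h
  case lam => exact of_rule₁ (.lamR _ _ _ _ _) h
  case lamIota x ψ y φ b =>
    -- The dummy identity is included only to force `a ≠ b`.
    obtain ⟨a, ha⟩ := exists_fresh (.eq (.par b) (.par b) ::ₘ φ ::ₘ (Γ + Δ))
    simp only [fresh_cons, fresh_add, HasPar, or_self, Term.par.injEq] at ha
    exact of_rule₃ (.iotaR _ _ _ _ _ _ b a ha.2.2.1 ha.2.2.2 ha.2.1 (Ne.symm ha.1)) h.1 h.2.1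
      (h.2.2 a)
  case relEq n X Y =>
    obtain ⟨a, hi, ha⟩ := exists_injective_fresh n (Γ + Δ)
    simp only [fresh_add, forall_and] at ha
    exact of_rule₂ (.relEqR _ _ n X Y a hi ha.1 ha.2) (h.1 a) (h.2 a)
  case lamIota₂ n X ψ Y φ B =>
    obtain ⟨A, hA⟩ := exists_fresh₂ n (.relEq (n := n) (.par B) (.par B) ::ₘ φ ::ₘ (Γ + Δ))
    simp only [fresh₂_cons, fresh₂_add, HasRPar, true_and, or_self, RTerm.par.injEq] at hA
    exact of_rule₃ (.iotaR₂ _ _ _ _ _ _ _ B A hA.2.2.1 hA.2.2.2 hA.2.1 (Ne.symm hA.1)) h.1 h.2.1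
      (h.2.2 A)

theorem of_leftPrem {I : Set (Premise L)} (hI : LeftPrem φ I)
    (h : ∀ p ∈ I, CutFreeProvable (p.1 + Γ ⟹ p.2 + Δ)) : CutFreeProvable (φ ::ₘ Γ ⟹ Δ) := by
  cases hI <;>
    simp only [Set.mem_insert_iff, Set.mem_singleton_iff, or_imp, forall_and,
      forall_eq, Set.forall_mem_range, Multiset.insert_eq_cons, Multiset.cons_add,
      Multiset.singleton_add, zero_add] at h
  case neg => exact of_rule₁ (.negL _ _ _) h
  case and => exact of_rule₁ (.andL _ _ _ _) h
  case or => exact of_rule₂ (.orL _ _ _ _) h.1 h.2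
  case imp => exact of_rule₂ (.impL _ _ _ _) h.1 h.2
  case iff => exact of_rule₂ (.iffL _ _ _ _) h.1 h.2
  case all => exact of_rule₁ (.allL _ _ _ _ _) h
  case ex x φ =>
    obtain ⟨a, ha⟩ := exists_fresh (φ ::ₘ (Γ + Δ))
    simp only [fresh_cons, fresh_add] at ha
    exact of_rule₁ (.exL _ _ _ _ a ha.2.1 ha.2.2 ha.1) (h a)
  case all₂ => exact of_rule₁ (.allL₂ _ _ _ _ _ _) h
  case ex₂ n X φ =>
    obtain ⟨A, hA⟩ := exists_fresh₂ n (φ ::ₘ (Γ + Δ))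
    simp only [fresh₂_cons, fresh₂_add] at hA
    exact of_rule₁ (.exL₂ _ _ _ _ _ A hA.2.1 hA.2.2 hA.1) (h A)
  case lam => exact of_rule₁ (.lamL _ _ _ _ _) h
  case lamIota x ψ y φ =>
    obtain ⟨a, ha⟩ := exists_fresh (φ ::ₘ ψ ::ₘ (Γ + Δ))
    simp only [fresh_cons, fresh_add] at ha
    exact of_rule₁ (.iotaL₁ _ _ _ _ _ _ a ha.2.2.1 ha.2.2.2 ha.1 ha.2.1) (h a)
  case lamIota_eq => exact of_rule₃ (.iotaL₂ _ _ _ _ _ _ _ _) h.1 h.2.1 h.2.2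
  case relEq => exact of_rule₂ (.relEqL _ _ _ _ _ _) h.1 h.2
  case lamIota₂ n X ψ Y φ =>
    obtain ⟨A, hA⟩ := exists_fresh₂ n (φ ::ₘ ψ ::ₘ (Γ + Δ))
    simp only [fresh₂_cons, fresh₂_add] at hA
    exact of_rule₁ (.iotaL₁₂ _ _ _ _ _ _ _ A hA.2.2.1 hA.2.2.2 hA.1 hA.2.1) (h A)
  case lamIota₂_eq => exact of_rule₃ (.iotaL₂₂ _ _ _ _ _ _ _ _ _) h.1 h.2.1 h.2.2

end CutFreeProvable

theorem Der.cutFreeProvable {Γ Δ : Multiset (Formula L)} (h : Der Γ Δ) :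
    CutFreeProvable (Γ ⟹ Δ) := by
  induction h with
  | ax φ h₁ h₂ =>
    obtain ⟨Γ, rfl⟩ := Multiset.exists_cons_of_mem h₁
    obtain ⟨Δ, rfl⟩ := Multiset.exists_cons_of_mem h₂
    have h : CutFreeProvable ({φ} ⟹ {φ}) := .node _ _ (.ax φ) (by simp)
    rw [← Multiset.singleton_add φ Γ, ← Multiset.singleton_add φ Δ, add_comm _ Γ, add_comm _ Δ]
    exact h.weaken Γ Δ
  | right φ I hI hφ _ ih => exact .contrR hφ (.of_rightPrem hI ih)
  | left φ I hI hφ _ ih => exact .contrL hφ (.of_leftPrem hI ih)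
  | eqPlus b _ ih => exact .of_rule₁ (.eqPlus _ _ b) ih
  | eqMinus x b c φ ha _ h₁ h₂ _ ih =>
    -- The original rule adds new copies of both the identity and the replaced atom; each is
    -- contracted into the copy already in the context.
    exact .contrL h₂ (.contrL (Multiset.mem_cons_of_mem h₁)
      (.of_rule₁ (.eqMinus _ _ x b c φ ha) ih))

theorem Provable.cutFreeProvable {S : Sequent L} (h : Provable S) : CutFreeProvable S := by
  have h := (h.der id fun _ => id).cutFreeProvable
  have hid : (ren id (fun _ => id) : Formula L → Formula L) = id := funext ren_id
  simpa [hid] using h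

/-! ### Sequents without free variables -/

namespace Formula

theorem varsBound_subst {x b : ℕ} {φ : Formula L} :
    (φ.subst x b).VarsBound ↔ (∀ y, y ≠ x → ¬ φ.FreeVar y) ∧ ∀ n X, ¬ φ.FreeRVar n X := by
  simp [VarsBound, freeVar_subst, freeRVar_subst]

theorem varsBound_subst₂ {n : ℕ+} {X B : ℕ} {φ : Formula L} :
    (φ.subst₂ n X B).VarsBound ↔
      (∀ y, ¬ φ.FreeVar y) ∧ ∀ m Y, ¬(m = n ∧ Y = X) → ¬ φ.FreeRVar m Y := by
  simp [VarsBound, freeVar_subst₂, freeRVar_subst₂]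

end Formula

/-- Read upwards, the rules other than Cut introduce no free variables. -/
theorem Rule.varsBound {ps : List (Sequent L)} {S : Sequent L} (h : Rule ps S)
    (hS : S.VarsBound) : ∀ P ∈ ps, P.VarsBound := by
  cases h <;> simp only [Sequent.VarsBound, List.mem_cons, List.not_mem_nil, or_false, or_imp,
    forall_and, forall_eq, Multiset.mem_cons, varsBound_subst, varsBound_subst₂] at hS ⊢ <;>
    simp only [Formula.VarsBound, FreeVar, FreeRVar] at hS ⊢ <;> grind

theorem ProvableBound.provable {S : Sequent L} (h : ProvableBound S) : Provable S := by
  induction h with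
  | node ps S hR _ ih => exact .node ps S hR.1 ih

theorem ProvableBound.varsBound {S : Sequent L} (h : ProvableBound S) : S.VarsBound := by
  cases h with
  | node ps S hR _ => exact hR.2

/-- The absence of free variables passes from the root to every premise. Cut would break this, since
its cut formula does not occur in the conclusion. -/
theorem CutFreeProvable.bound {S : Sequent L} (h : CutFreeProvable S) (hS : S.VarsBound) :
    CutFreeProvableBound S := by
  induction h with
  | node ps S hR _ ih => exact .node ps S ⟨hR, hS⟩ fun P hP => ih P hP (hR.varsBound hS P hP)

end RLL

theorem mainTheorem2 (L : RLL.Signature) (S : RLL.Sequent L) :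
    (RLL.Provable S → RLL.CutFreeProvable S) ∧
    (RLL.ProvableBound S → RLL.CutFreeProvableBound S) :=
  ⟨fun h => h.cutFreeProvable, fun h => h.provable.cutFreeProvable.bound h.varsBound⟩
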